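/- Let $M$ be a monoid with identity $1$. Green's relations on $M$ are given by: $x\,\mathcal{L}\,y$ if $Mx=My$; $x\,\mathcal{R}\,y$ if $xM=yM$; $x\,\mathcal{H}\,y$ if both hold; $x\,\mathcal{J}\,y$ if $MxM=MyM$; and $x\,\mathcal{D}\,y$ if there is $z\in M$ with $x\,\mathcal{L}\,z$ and $z\,\mathcal{R}\,y$. For an $\mathcal{H}$-class $H$, the (right) Schützenberger group of $H$ is the group of all permutations $\sigma$ of $H$ for which there is $m\in M$ with $\sigma(h)=hm$ for all $h\in H$; all $\mathcal{H}$-classes in one $\mathcal{D}$-class $D$ have isomorphic Schützenberger groups, and "the Schützenberger group of $D$" is any one of them. An action of a group $G$ on a set $X$ is called locally amenable if for every orbit in $X$ the quotient of $G$ by the pointwise stabiliser of the orbit is an amenable group, that is, a group with a finitely additive translation-invariant probability measure defined on all of its subsets. The monoid $M$ is called (left) sofic if for every finite $K\subseteq M$ and every $\epsilon>0$ there are a finite nonempty set $X$ and a map $M\times X\to X$, $(m,x)\mapsto m\cdot x$, such that $1\cdot x=x$ for all $x\in X$; for all $g,h\in K$ the proportion of $x\in X$ with $g\cdot(h\cdot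 x)=(gh)\cdot x$ is at least $1-\epsilon$; and for all distinct $g,h\in K$ the proportion of $x\in X$ with $g\cdot x=h\cdot x$ is at most $\epsilon$. A group $G$ is called sofic if for every finite $K\subseteq G$ and every $\epsilon>0$ there are a finite nonempty set $X$ and a map $\varphi$ from $G$ to the symmetric group of $X$ such that, for the normalised Hamming distance $d$, one has $d(\varphi(gh),\varphi(g)\varphi(h))\le\epsilon$ for all $g,h\in K$ and $d(\varphi(g),\varphi(h))\ge 1-\epsilon$ for all distinct $g,h\in K$. **Theorem.** Let $M$ be a monoid in which the $\mathcal{J}$-class of the identity is a sofic group $G$ (so that $G$ is the group of units of $M$). The right translation action of $G$ on $M$ preserves $\mathcal{H}$ and maps each $\mathcal{D}$-class to itself, so $G$ acts on the set of $\mathcal{H}$-classes in each $\mathcal{D}$-class. Suppose that for every $\mathcal{D}$-class $D$ of $M$ consisting of non-units, at least one of the following conditions holds: (i) there are finitely many $\mathcal{L}$-classes in $D$, and the Schützenberger group of $D$ is amenable; or (ii) the Schützenberger group of $D$ is finite or abelian, and the action of $G$ on the set of $\mathcal{H}$-classes in $D$ is locally amenable. Then $M$ is sofic. -/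

import Mathlib

noncomputable section

/-! ### Sofic groups and sofic monoids -/

/-- The proportion of elements of the finite set `X` that satisfy `p`. -/
def proportion {X : Type} (p : X → Prop) : ℝ :=
  (Nat.card {x : X // p x} : ℝ) / (Nat.card X : ℝ)

/-- `(m, x) ↦ act m x` is a left `(K, ε)`-action of the monoid `M` on `X`. -/
structure IsLeftAlmostAction {M : Type*} [Monoid M] (K : Finset M) (ε : ℝ) {X : Type}
    (act : M → X → X) : Prop where
  one_act : ∀ x, act 1 x = x
  mul_act : ∀ g ∈ K, ∀ h ∈ K, 1 - ε ≤ proportion fun x => act g (act h x) = act (g * h) x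
  act_ne : ∀ g ∈ K, ∀ h ∈ K, g ≠ h → proportion (fun x => act g x = act h x) ≤ ε

/-- (Left) sofic monoids. The finite set `X` has to be nonempty for proportions to make sense. -/
def IsSoficMonoid (M : Type*) [Monoid M] : Prop :=
  ∀ (K : Finset M) (ε : ℝ), 0 < ε →
    ∃ (X : Type) (_ : Finite X) (_ : Nonempty X) (act : M → X → X), IsLeftAlmostAction K ε act

/-- The normalised Hamming distance on the symmetric group of a finite set. -/
def hammingPerm {X : Type} (σ τ : Equiv.Perm X) : ℝ :=
  proportion fun x => σ x ≠ τ x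

/-- Sofic groups, in the usual sense: every finite part of the group is approximated by
permutations of a nonempty finite set, with respect to the normalised Hamming distance. -/
def IsSoficGroup (G : Type*) [Group G] : Prop :=
  ∀ (K : Finset G) (ε : ℝ), 0 < ε →
    ∃ (X : Type) (_ : Finite X) (_ : Nonempty X) (φ : G → Equiv.Perm X),
      (∀ g ∈ K, ∀ h ∈ K, hammingPerm (φ (g * h)) (φ g * φ h) ≤ ε) ∧
      (∀ g ∈ K, ∀ h ∈ K, g ≠ h → 1 - ε ≤ hammingPerm (φ g) (φ h))

/-! ### Amenable groups and locally amenable actions -/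

/-- A group is amenable if it admits a finitely additive probability measure, defined on all
subsets, which is invariant under left translation. -/
def IsAmenable (G : Type*) [Group G] : Prop :=
  ∃ μ : Set G → ℝ,
    (∀ A, 0 ≤ μ A) ∧ μ Set.univ = 1 ∧
    (∀ A B, Disjoint A B → μ (A ∪ B) = μ A + μ B) ∧
    (∀ (g : G) (A : Set G), μ ((fun x => g * x) '' A) = μ A)

/-- The pointwise stabiliser of an orbit is a normal subgroup. -/
instance fixingSubgroup_orbit_normal (G : Type*) {X : Type*} [Group G] [MulAction G X] (x : X) :
    (fixingSubgroup G (MulAction.orbit G x)).Normal := by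
  refine ⟨fun n hn g => ?_⟩
  rw [mem_fixingSubgroup_iff] at hn ⊢
  intro y hy
  have hy' : g⁻¹ • y ∈ MulAction.orbit G x := by
    obtain ⟨k, rfl⟩ := hy
    exact ⟨g⁻¹ * k, mul_smul _ _ _⟩
  rw [mul_smul, mul_smul, hn _ hy', smul_inv_smul]

/-- The action of `G` on `X` is locally amenable: for every orbit, the quotient of `G` by the
pointwise stabiliser of the orbit is amenable. -/
def IsLocallyAmenable (G X : Type*) [Group G] [MulAction G X] : Prop :=
  ∀ x : X, IsAmenable (G ⧸ fixingSubgroup G (MulAction.orbit G x))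

/-! ### Green's relations -/

section Green

variable (M : Type*) [Monoid M]

/-- `x 𝓛 y` iff `Mx = My`. -/
def greenL : Setoid M := Setoid.ker fun x : M => Set.range fun m : M => m * x

/-- `x 𝓡 y` iff `xM = yM`. -/
def greenR : Setoid M := Setoid.ker fun x : M => Set.range fun m : M => x * m

/-- `x 𝓗 y` iff `Mx = My` and `xM = yM`. -/
def greenH : Setoid M := greenL M ⊓ greenR M

/-- `x 𝓙 y` iff `MxM = MyM`. -/
def greenJ : Setoid M := Setoid.ker fun x : M => Set.range fun p : M × M => p.1 * x * p.2

variable {M}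

theorem greenL_iff {x y : M} : greenL M x y ↔ (∃ a, a * y = x) ∧ ∃ b, b * x = y := by
  change Set.range _ = Set.range _ ↔ _
  constructor
  · intro h
    constructor
    · have : x ∈ Set.range fun m : M => m * x := ⟨1, one_mul x⟩
      rwa [h] at this
    · have : y ∈ Set.range fun m : M => m * y := ⟨1, one_mul y⟩
      rwa [← h] at this
  · rintro ⟨⟨a, ha⟩, b, hb⟩
    ext z
    constructor
    · rintro ⟨m, rfl⟩
      exact ⟨m * a, by simp only [mul_assoc, ha]⟩
    · rintro ⟨m, rfl⟩
      exact ⟨m * b, by simp only [mul_assoc, hb]⟩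

theorem greenR_iff {x y : M} : greenR M x y ↔ (∃ a, y * a = x) ∧ ∃ b, x * b = y := by
  change Set.range _ = Set.range _ ↔ _
  constructor
  · intro h
    constructor
    · have : x ∈ Set.range fun m : M => x * m := ⟨1, mul_one x⟩
      rwa [h] at this
    · have : y ∈ Set.range fun m : M => y * m := ⟨1, mul_one y⟩
      rwa [← h] at this
  · rintro ⟨⟨a, ha⟩, b, hb⟩
    ext z
    constructor
    · rintro ⟨m, rfl⟩
      exact ⟨a * m, by simp only [← mul_assoc, ha]⟩
    · rintro ⟨m, rfl⟩
      exact ⟨b * m, by simp only [← mul_assoc, hb]⟩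

theorem greenL_mul_right {x y : M} (h : greenL M x y) (m : M) : greenL M (x * m) (y * m) := by
  rw [greenL_iff] at h ⊢
  obtain ⟨⟨a, ha⟩, b, hb⟩ := h
  exact ⟨⟨a, by rw [← mul_assoc, ha]⟩, b, by rw [← mul_assoc, hb]⟩

theorem greenR_mul_left {x y : M} (h : greenR M x y) (m : M) : greenR M (m * x) (m * y) := by
  rw [greenR_iff] at h ⊢
  obtain ⟨⟨a, ha⟩, b, hb⟩ := h
  exact ⟨⟨a, by rw [mul_assoc, ha]⟩, b, by rw [mul_assoc, hb]⟩

theorem greenR_mul_unit (x : M) (g : Mˣ) : greenR M (x * g) x := by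
  rw [greenR_iff]
  exact ⟨⟨g, rfl⟩, ((g⁻¹ : Mˣ) : M), by simp⟩

/-- The relations `𝓛` and `𝓡` commute. -/
theorem greenL_greenR_comm {x y : M} :
    (∃ z, greenL M x z ∧ greenR M z y) ↔ ∃ w, greenR M x w ∧ greenL M w y := by
  constructor
  · rintro ⟨z, hL, hR⟩
    obtain ⟨⟨b, hb⟩, a, ha⟩ := greenL_iff.1 hL
    obtain ⟨-, c, hc⟩ := greenR_iff.1 hR
    refine ⟨x * c, ?_, ?_⟩
    · have := greenR_mul_left hR b
      rwa [hb, ← hc, ← mul_assoc, hb] at this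
    · have := greenL_mul_right hL c
      rwa [hc] at this
  · rintro ⟨w, hR, hL⟩
    obtain ⟨⟨b, hb⟩, a, ha⟩ := greenR_iff.1 hR
    obtain ⟨-, c, hc⟩ := greenL_iff.1 hL
    refine ⟨c * x, ?_, ?_⟩
    · have := greenL_mul_right hL b
      rwa [hb, ← hc, mul_assoc, hb] at this
    · have := greenR_mul_left hR c
      rwa [hc] at this

variable (M)

/-- `x 𝓓 y` iff there is `z` with `x 𝓛 z` and `z 𝓡 y`. -/
def greenD : Setoid M where
  r x y := ∃ z, greenL M x z ∧ greenR M z y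
  iseqv := by
    refine ⟨fun x => ⟨x, (greenL M).refl x, (greenR M).refl x⟩, ?_, ?_⟩
    · intro x y h
      obtain ⟨w, hR, hL⟩ := greenL_greenR_comm.1 h
      exact ⟨w, (greenL M).symm hL, (greenR M).symm hR⟩
    · rintro x y z ⟨u, hxu, huy⟩ ⟨v, hyv, hvz⟩
      obtain ⟨w, huw, hwv⟩ := greenL_greenR_comm.2 ⟨y, huy, hyv⟩
      exact ⟨w, (greenL M).trans hxu huw, (greenR M).trans hwv hvz⟩

/-- The set of `𝓗`-classes of `M`. -/
def HClass : Type _ := Quotient (greenH M)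

/-- The set of `𝓓`-classes of `M`. -/
def DClass : Type _ := Quotient (greenD M)

variable {M}

/-- The `𝓗`-class of an element. -/
def HClass.mk (x : M) : HClass M := Quotient.mk (greenH M) x

/-- The `𝓓`-class of an element. -/
def DClass.mk (x : M) : DClass M := Quotient.mk (greenD M) x

/-- The set of `𝓛`-classes contained in a given `𝓓`-class. -/
def DClass.lClasses (D : DClass M) : Set (Quotient (greenL M)) :=
  {c | ∃ x : M, DClass.mk x = D ∧ Quotient.mk (greenL M) x = c}

/-! ### Schützenberger groups -/

/-- The (right) Schützenberger group of the `𝓗`-class `H` of `x`: all permutations of `H` that are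
realised by right translation by some element of `M`. (Permutations are composed here from right
to left; composing them from left to right gives the opposite group, which is isomorphic to this
one through inversion.) -/
def schutzenbergerGroup (x : M) : Subgroup (Equiv.Perm {y : M // greenH M y x}) where
  carrier := {σ | ∃ m : M, ∀ h, (σ h : M) = h * m}
  one_mem' := ⟨1, fun h => by simp⟩
  mul_mem' := by
    rintro σ τ ⟨m, hm⟩ ⟨n, hn⟩
    exact ⟨n * m, fun h => by rw [Equiv.Perm.mul_apply, hm, hn, mul_assoc]⟩
  inv_mem' := by
    rintro σ ⟨m, hm⟩
    let x' : {y : M // greenH M y x} := ⟨x, (greenH M).refl x⟩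
    have hR : greenR M (σ x') x := (σ x').2.2
    obtain ⟨-, n, hn⟩ := greenR_iff.1 hR
    rw [hm] at hn
    have key : ∀ h : {y : M // greenH M y x}, (h : M) * m * n = h := by
      intro h
      obtain ⟨⟨a, ha⟩, -⟩ := greenL_iff.1 h.2.1
      rw [← ha, mul_assoc, mul_assoc, ← mul_assoc x, hn]
    refine ⟨n, fun h => ?_⟩
    have h1 := key (σ⁻¹ h)
    have h2 : σ (σ⁻¹ h) = h := σ.apply_symm_apply h
    rw [← hm, h2] at h1
    exact h1.symm

/-! ### The action of the group of units on the set of `𝓗`-classes -/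

/-- The right action `[m] ∘ g = [m g]` of the group of units `G = Mˣ` on the set of `𝓗`-classes,
as a left action of the opposite group. -/
instance : MulAction (Mˣ)ᵐᵒᵖ (HClass M) where
  smul g := Quotient.map' (s₁ := greenH M) (s₂ := greenH M) (fun m : M => m * (g.unop : Mˣ))
    fun m n h => ⟨greenL_mul_right h.1 _,
      (greenR M).trans (greenR_mul_unit m _)
        ((greenR M).trans h.2 ((greenR M).symm (greenR_mul_unit n _)))⟩
  one_smul := by
    rintro ⟨m⟩
    exact congrArg HClass.mk (mul_one m)
  mul_smul g h := by
    rintro ⟨m⟩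
    exact congrArg HClass.mk (mul_assoc m (h.unop : M) (g.unop : M)).symm

theorem HClass.op_smul_mk (g : Mˣ) (m : M) :
    MulOpposite.op g • HClass.mk m = HClass.mk (m * g) := rfl

/-- The set of `𝓗`-classes contained in the `𝓓`-class `D`, with the restricted action of the
group of units. -/
def DClass.hClasses (D : DClass M) : SubMulAction (Mˣ)ᵐᵒᵖ (HClass M) where
  carrier := {c | ∃ x : M, DClass.mk x = D ∧ HClass.mk x = c}
  smul_mem' := by
    rintro g _ ⟨x, rfl, rfl⟩
    refine ⟨x * (g.unop : Mˣ), Quotient.sound ?_, rfl⟩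
    exact ⟨x * (g.unop : Mˣ), (greenL M).refl _, greenR_mul_unit x _⟩

end Green

end

/-! Let `m` be a non-unit. The units fixing the orbit `m G` pointwise form a normal subgroup
`orbitFixer m`, and the heart of the matter is that `G` modulo this subgroup is amenable. Indeed,
`G` acts on the `𝓗`-classes meeting `m G`. The units acting trivially there act on each such class
through its Schützenberger group, so modulo `orbitFixer m` they embed in a power of that group.
Under (i) the orbit of classes is finite and so is the power. Under (ii) the power may be infinite,
but it is abelian or locally finite, while the action on the classes is controlled by local
amenability. An extension argument (`FolnerAction.tower`) combines the two layers. This is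
`folner_orbitFixer_of_finite` and `folner_orbitFixer_of_isLocallyAmenable`.

Given a finite `K`, intersect the `orbitFixer k` over the non-units `k ∈ K` to get `N`, still with
amenable quotient. Take a Følner set `F` of cosets of `N` and a sofic approximation `Y` of `G`.
Units act diagonally on many copies of `Y × F`. A non-unit `m` sends a point over the coset of `f`
to `m f⁻¹`, in a finite set `S` of non-negotiably few elements of `M` on which `M` acts by left
multiplication where possible. Because `N` fixes `m G`, the equality `m (h f⁻¹) = (m h) f⁻¹` does
not depend on the chosen representatives, which makes units and non-units compatible. Enough copies
of `Y × F` make `S` negligible. `isSoficMonoid_of_folner` carries this out. -/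

open scoped Classical in
/-- The pairs `(k, x)` in `K × F` such that `k` moves `x` out of `F`. -/
noncomputable def displaced {G X : Type*} [SMul G X] (K : Finset G) (F : Finset X) :
    Finset (G × X) :=
  (K ×ˢ F).filter fun p => p.1 • p.2 ∉ F

theorem mem_displaced {G X : Type*} [SMul G X] {K : Finset G} {F : Finset X} {p : G × X} :
    p ∈ displaced K F ↔ (p.1 ∈ K ∧ p.2 ∈ F) ∧ p.1 • p.2 ∉ F := by
  simp [displaced]

/-- The action of `G` on `X` satisfies the Følner condition. -/
def FolnerAction (G X : Type*) [Group G] [MulAction G X] : Prop :=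
  ∀ (K : Finset G) (ε : ℝ), 0 < ε → ∃ F : Finset X, F.Nonempty ∧
    ((displaced K F).card : ℝ) ≤ ε * F.card

/-! ### Følner sets for amenable, abelian and locally finite groups -/

section Folner

open scoped Classical Pointwise

/-- A finitely additive probability measure is additive over finite disjoint families. -/
theorem finitelyAdditive_biUnion {G ι : Type*} {μ : Set G → ℝ}
    (hadd : ∀ A B, Disjoint A B → μ (A ∪ B) = μ A + μ B) (s : Finset ι) (A : ι → Set G)
    (hA : (s : Set ι).PairwiseDisjoint A) : μ (⋃ i ∈ s, A i) = ∑ i ∈ s, μ (A i) := by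
  have h0 : μ ∅ = 0 := by
    have := hadd ∅ ∅ (by simp)
    simp only [Set.union_self] at this
    linarith
  induction s using Finset.induction_on with
  | empty => simp [h0]
  | insert a s ha ih =>
    rw [Finset.set_biUnion_insert, Finset.sum_insert ha, hadd, ih]
    · exact hA.subset (by simp)
    · rw [Set.disjoint_iUnion₂_right]
      intro i hi
      exact hA (by simp) (by simp [hi]) (by rintro rfl; exact ha hi)

/-- Such a `ψ` is a paradoxical decomposition. For each `b` the pieces `A (b, e)` partition `G`, so
their measures add up to 1. Injectivity makes all the translates `e A (b, e)` disjoint, so an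
invariant measure would give their union mass 2. -/
theorem IsAmenable.not_exists_injective {G : Type*} [Group G] (h : IsAmenable G) (E : Finset G)
    (ψ : G × Bool → G) (hψ : Function.Injective ψ) (hE : ∀ x, ψ x * x.1⁻¹ ∈ E) : False := by
  obtain ⟨μ, hpos, huniv, hadd, hinv⟩ := h
  let A : Bool × G → Set G := fun p => {g | ψ (g, p.1) * g⁻¹ = p.2}
  have h1 : ∀ b, ∑ e ∈ E, μ (A (b, e)) = 1 := by
    intro b
    rw [← finitelyAdditive_biUnion hadd E fun e => A (b, e), ← huniv]
    · congr 1
      ext g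
      simpa [A] using hE (g, b)
    · intro e _ e' _ hne
      rw [Function.onFun, Set.disjoint_left]
      intro g hg hg'
      exact hne (hg.symm.trans hg')
  have h2 : μ (⋃ p ∈ Finset.univ ×ˢ E, (fun x => p.2 * x) '' A p) = 2 := by
    rw [finitelyAdditive_biUnion hadd]
    · simp only [hinv]
      rw [Finset.sum_product]
      simp [h1]
    · rintro ⟨b, e⟩ _ ⟨b', e'⟩ _ hne
      rw [Function.onFun, Set.disjoint_left]
      rintro _ ⟨g, hg, rfl⟩ ⟨g', hg', h⟩
      simp only [A, Set.mem_ofPred_eq] at hg hg' h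
      subst hg hg'
      simp only [inv_mul_cancel_right] at h
      have := hψ h
      simp only [Prod.mk.injEq] at this
      obtain ⟨rfl, rfl⟩ := this
      exact hne rfl
  have h3 := hadd _ _ (disjoint_compl_right
    (a := ⋃ p ∈ Finset.univ ×ˢ E, (fun x => p.2 * x) '' A p))
  rw [Set.union_compl_self, huniv, h2] at h3
  linarith [hpos (⋃ p ∈ Finset.univ ×ˢ E, (fun x => p.2 * x) '' A p)ᶜ]

/-- If `K` contains the identity and `K F` is always larger than `F` by a constant factor, then
`G` is not amenable. -/
theorem IsAmenable.not_expanding {G : Type*} [Group G] (h : IsAmenable G) (K : Finset G)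
    {δ : ℝ} (hδ : 0 < δ) (hK : ∀ F : Finset G, (1 + δ) * F.card ≤ (K * F).card) : False := by
  have hpow : ∀ (n : ℕ) (F : Finset G), (1 + δ) ^ n * F.card ≤ ((K ^ n * F).card : ℝ) := by
    intro n
    induction n with
    | zero => simp
    | succ n ih =>
      intro F
      have h1 := ih (K * F)
      rw [← mul_assoc, ← pow_succ] at h1
      refine le_trans ?_ h1
      rw [pow_succ, mul_assoc]
      exact mul_le_mul_of_nonneg_left (hK F) (by positivity)
  obtain ⟨n, hn⟩ := pow_unbounded_of_one_lt 2 (show 1 < 1 + δ by linarith)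
  -- Hall's marriage theorem: once `K ^ n` at least doubles every finite set, two copies of `G` can
  -- be matched injectively into `G`, moving points only by elements of `K ^ n`.
  obtain ⟨ψ, hψ, hψ'⟩ := (Finset.all_card_le_biUnion_card_iff_exists_injective
    (fun x : G × Bool => K ^ n * {x.1})).1 (by
      intro s
      have h1 : s.card ≤ (s.image Prod.fst).card * 2 := by
        refine (Finset.card_le_card (t := s.image Prod.fst ×ˢ Finset.univ) ?_).trans ?_
        · intro x hx
          simp only [Finset.mem_product, Finset.mem_univ, and_true]
          exact Finset.mem_image_of_mem _ hx
        · simp [Finset.card_product]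
      have h2 : s.biUnion (fun x : G × Bool => K ^ n * {x.1}) = K ^ n * s.image Prod.fst := by
        ext g
        simp only [Finset.mem_biUnion, Finset.mem_mul, Finset.mem_singleton, Finset.mem_image]
        constructor
        · rintro ⟨x, hx, y, hy, _, rfl, rfl⟩
          exact ⟨y, hy, _, ⟨x, hx, rfl⟩, rfl⟩
        · rintro ⟨y, hy, _, ⟨x, hx, rfl⟩, rfl⟩
          exact ⟨x, hx, y, hy, _, rfl, rfl⟩
      rw [h2]
      have h3 := hpow n (s.image Prod.fst)
      have h4 : ((s.image Prod.fst).card : ℝ) * 2 ≤ ((K ^ n * s.image Prod.fst).card : ℝ) := by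
        refine le_trans ?_ h3
        rw [mul_comm]
        exact mul_le_mul_of_nonneg_right hn.le (by positivity)
      exact h1.trans (by exact_mod_cast h4))
  refine h.not_exists_injective (K ^ n) ψ hψ fun x => ?_
  obtain ⟨y, hy, z, hz, hyz⟩ := Finset.mem_mul.1 (hψ' x)
  rw [Finset.mem_singleton] at hz
  rwa [← hyz, hz, mul_inv_cancel_right]

/-- The elements moved out of `F` by `K` are bounded by the growth of `F`. -/
theorem card_filter_smul_notMem_le {G : Type*} [Group G] (K F F' : Finset G) (h : K * F ⊆ F') :
    (displaced K F).card ≤ K.card * (F' \ F).card := by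
  rw [← Finset.card_product]
  refine Finset.card_le_card_of_injOn (fun p => (p.1, p.1 * p.2)) ?_ ?_
  · rintro ⟨k, f⟩ hp
    replace hp := mem_displaced.1 hp
    simp only [smul_eq_mul] at hp
    simp only [Finset.coe_product, Set.mem_prod, Finset.mem_coe, Finset.mem_sdiff]
    exact ⟨hp.1.1, h (Finset.mul_mem_mul hp.1.1 hp.1.2), hp.2⟩
  · rintro ⟨k, f⟩ _ ⟨k', f'⟩ _ h
    simp only [Prod.mk.injEq] at h
    obtain ⟨rfl, h⟩ := h
    rw [mul_left_cancel h]

/-- Følner's theorem. -/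
theorem IsAmenable.folner {G : Type*} [Group G] (h : IsAmenable G) : FolnerAction G G := by
  intro K ε hε
  by_contra! hF
  -- If no Følner set exists, more than `ε |F|` pairs are displaced. At most `|K|` pairs lead to the
  -- same new point, so `F` grows by a fixed factor. The `+ 1` covers an empty `K`.
  have hd : (0 : ℝ) < K.card + 1 := by positivity
  refine h.not_expanding (insert 1 K) (δ := ε / (K.card + 1)) (by positivity) fun F => ?_
  rcases F.eq_empty_or_nonempty with rfl | hne
  · simp
  have h1 := hF F hne
  have hsub : F ⊆ insert 1 K * F := fun x hx => by
    simpa using Finset.mul_mem_mul (Finset.mem_insert_self 1 K) hx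
  have h2 := card_filter_smul_notMem_le K F (insert 1 K * F)
    (Finset.mul_subset_mul_right (Finset.subset_insert _ _))
  have h3 := Finset.card_sdiff_add_card_eq_card hsub
  have h2' : ((displaced K F).card : ℝ)
    ≤ K.card * ((insert 1 K * F) \ F).card := by exact_mod_cast h2
  have h3' : (((insert 1 K * F) \ F).card : ℝ) + F.card = (insert 1 K * F).card := by
    exact_mod_cast h3
  have h4 : ε / (K.card + 1) * F.card ≤ ((insert 1 K * F) \ F).card := by
    rw [div_mul_eq_mul_div, div_le_iff₀ hd]
    nlinarith [(Nat.cast_nonneg _ : (0 : ℝ) ≤ (((insert 1 K * F) \ F).card : ℝ))]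
  linarith

/-- Abelian groups satisfy the Følner condition. -/
theorem folner_of_comm {C : Type*} [CommGroup C] : FolnerAction C C := by
  intro K ε hε
  by_contra! hF
  -- The monomials in `K` with exponents at most `n`: their number is polynomial in `n`, whereas
  -- failure of the Følner condition would force exponential growth.
  let B : ℕ → Finset C := fun n =>
    (Fintype.piFinset fun _ : K => Finset.range (n + 1)).image fun a => ∏ k : K, (k : C) ^ a k
  have hBne : ∀ n, (B n).Nonempty := fun n =>
    Finset.Nonempty.image ⟨fun _ => 0, by simp⟩ _
  have hmono : ∀ n, B n ⊆ B (n + 1) := fun n =>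
    Finset.image_subset_image (Fintype.piFinset_subset _ _ fun _ =>
      Finset.range_mono (by omega))
  have hmul : ∀ n, K * B n ⊆ B (n + 1) := by
    intro n x hx
    obtain ⟨k, hk, y, hy, rfl⟩ := Finset.mem_mul.1 hx
    obtain ⟨a, ha, rfl⟩ := Finset.mem_image.1 hy
    refine Finset.mem_image.2 ⟨a + Pi.single ⟨k, hk⟩ 1, ?_, ?_⟩
    · rw [Fintype.mem_piFinset] at ha ⊢
      intro i
      have := ha i
      simp only [Finset.mem_range, Pi.add_apply] at this ⊢
      have h1 : (Pi.single ⟨k, hk⟩ 1 : K → ℕ) i ≤ 1 := by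
        by_cases hi : i = ⟨k, hk⟩
        · subst hi; simp
        · simp [hi]
      omega
    · simp only [Pi.add_apply, pow_add, Finset.prod_mul_distrib]
      rw [mul_comm]
      congr 1
      rw [Finset.prod_eq_single ⟨k, hk⟩] <;> simp +contextual
  have hcard : ∀ n, (B n).card ≤ (n + 1) ^ K.card := fun n =>
    Finset.card_image_le.trans (by simp)
  have hd : (0 : ℝ) < K.card + 1 := by positivity
  set δ := ε / (K.card + 1) with hδ
  have hδ0 : 0 < δ := by positivity
  have hgrow : ∀ n : ℕ, (1 + δ) ^ n ≤ ((B n).card : ℝ) := by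
    intro n
    induction n with
    | zero => simpa using hBne 0
    | succ n ih =>
      have h1 := hF (B n) (hBne n)
      have h2 : ((displaced K (B n)).card : ℝ)
          ≤ K.card * (B (n + 1) \ B n).card := by
        exact_mod_cast card_filter_smul_notMem_le K (B n) (B (n + 1)) (hmul n)
      have h3 : ((B (n + 1) \ B n).card : ℝ) + (B n).card = (B (n + 1)).card := by
        exact_mod_cast Finset.card_sdiff_add_card_eq_card (hmono n)
      have h4 : δ * (B n).card ≤ (B (n + 1) \ B n).card := by
        rw [hδ, div_mul_eq_mul_div, div_le_iff₀ hd]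
        nlinarith [(Nat.cast_nonneg _ : (0 : ℝ) ≤ ((B (n + 1) \ B n).card : ℝ))]
      rw [pow_succ]
      nlinarith
  -- The shift to `n + 1` matches the bound `(n + 1) ^ |K|`; the extra factor `1 + δ` is absorbed by
  -- the threshold `(1 + δ)⁻¹`.
  have hlim := (tendsto_pow_const_div_const_pow_of_one_lt K.card
    (show 1 < 1 + δ by linarith)).comp (Filter.tendsto_add_atTop_nat 1)
  have hev := hlim.eventually (gt_mem_nhds (show 0 < (1 + δ)⁻¹ by positivity))
  obtain ⟨n, hn⟩ := hev.exists
  simp only [Function.comp_apply] at hn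
  rw [div_lt_iff₀ (by positivity), pow_succ (1 + δ), mul_comm ((1 + δ) ^ n), ← mul_assoc,
    inv_mul_cancel₀ (by positivity), one_mul] at hn
  have h1 : ((B n).card : ℝ) ≤ ((n + 1 : ℕ) : ℝ) ^ K.card := by exact_mod_cast hcard n
  linarith [hgrow n]

/-- Powers of a finite group are locally finite, hence satisfy the Følner condition. -/
theorem folner_pi_of_finite {ι Γ : Type*} [Group Γ] [Finite Γ] :
    FolnerAction (ι → Γ) (ι → Γ) := by
  intro K ε hε
  -- `τ i` records the values at `i` of all members of `K`. Only finitely many profiles occur, so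
  -- the functions that depend on `i` through `τ i` alone form a finite set invariant under `K`.
  let τ : ι → K → Γ := fun i k => (k : ι → Γ) i
  have hfin : (Set.range fun (q : (K → Γ) → Γ) (i : ι) => q (τ i)).Finite := Set.finite_range _
  refine ⟨hfin.toFinset, ⟨fun _ => 1, by simpa using ⟨fun _ => 1, rfl⟩⟩, ?_⟩
  rw [Finset.eq_empty_of_forall_notMem (s := displaced K _)]
  · simp only [Finset.card_empty, Nat.cast_zero]; positivity
  · rintro ⟨k, f⟩ hp
    rw [mem_displaced, Set.Finite.mem_toFinset] at hp
    obtain ⟨⟨hk, q, rfl⟩, hn⟩ := hp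
    rw [Set.Finite.mem_toFinset] at hn
    exact hn ⟨fun v => v ⟨k, hk⟩ * q v, rfl⟩

theorem folner_of_finite {G X : Type*} [Group G] [MulAction G X] [Finite X] [Nonempty X] :
    FolnerAction G X := by
  intro K ε hε
  have := Fintype.ofFinite X
  refine ⟨Finset.univ, Finset.univ_nonempty, ?_⟩
  rw [Finset.eq_empty_of_forall_notMem (s := displaced K _)]
  · simp only [Finset.card_empty, Nat.cast_zero]; positivity
  · exact fun p hp => (mem_displaced.1 hp).2 (Finset.mem_univ _)

end Folner

/-! ### Følner conditions on coset spaces and extensions -/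

section FolnerQuotient

open scoped Classical Pointwise

theorem FolnerAction.comp_hom {G P X : Type*} [Group G] [Group P] [MulAction P X]
    [MulAction G X] (h : FolnerAction P X) (ψ : G →* P) (hψ : ∀ (g : G) (x : X), g • x = ψ g • x) :
    FolnerAction G X := by
  intro K ε hε
  obtain ⟨F, hne, hF⟩ := h (K.image ψ) (ε / (K.card + 1)) (by positivity)
  refine ⟨F, hne, ?_⟩
  have h1 : (displaced K F).card ≤
      K.card * (displaced (K.image ψ) F).card := by
    rw [← Finset.card_product]
    refine Finset.card_le_card_of_injOn (fun p => (p.1, ψ p.1, p.2)) ?_ ?_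
    · rintro ⟨k, f⟩ hp
      simp only [Finset.mem_coe, mem_displaced, hψ] at hp
      simp only [Finset.coe_product, Set.mem_prod, Finset.mem_coe, mem_displaced]
      exact ⟨hp.1.1, ⟨Finset.mem_image_of_mem _ hp.1.1, hp.1.2⟩, hp.2⟩
    · rintro ⟨k, f⟩ _ ⟨k', f'⟩ _ h
      simp only [Prod.mk.injEq] at h
      rw [h.1, h.2.2]
  have h1' : ((displaced K F).card : ℝ) ≤
      K.card * (displaced (K.image ψ) F).card := by exact_mod_cast h1
  refine h1'.trans ?_
  rw [div_mul_eq_mul_div, le_div_iff₀ (by positivity)] at hF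
  nlinarith [(Nat.cast_nonneg _ :
    (0 : ℝ) ≤ ((displaced (K.image ψ) F).card : ℝ))]

/-- If all stabilisers of a Følner action are the same, then the action on the cosets of this
stabiliser satisfies the Følner condition. -/
theorem FolnerAction.of_stabilizer_eq {G X : Type*} [Group G] [MulAction G X]
    (h : FolnerAction G X) (N : Subgroup G) (hN : ∀ x : X, MulAction.stabilizer G x = N) :
    FolnerAction G (G ⧸ N) := by
  intro K ε hε
  obtain ⟨F, hne, hF⟩ := h K ε hε
  let π : X → MulAction.orbitRel.Quotient G X := Quotient.mk _
  have hπ : ∀ (g : G) x, π (g • x) = π x := fun g x =>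
    Quotient.sound (MulAction.orbitRel_apply.2 (MulAction.mem_orbit _ _))
  set b := displaced K F with hb
  have h1 : b.card = ∑ o ∈ F.image π, (b.filter fun p => π p.2 = o).card :=
    Finset.card_eq_sum_card_fiberwise fun p hp => by
      rw [hb, Finset.mem_coe, mem_displaced] at hp
      exact Finset.mem_coe.2 (Finset.mem_image_of_mem _ hp.1.2)
  have h2 : F.card = ∑ o ∈ F.image π, (F.filter fun x => π x = o).card :=
    Finset.card_eq_sum_card_image π F
  rw [h1, h2] at hF
  push_cast at hF
  rw [Finset.mul_sum] at hF
  -- Displaced pairs and points of `F` are both counted orbit by orbit, so by averaging some orbit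
  -- meeting `F` satisfies the Følner inequality by itself.
  obtain ⟨o, ho, hle⟩ := Finset.exists_le_of_sum_le (hne.image π) hF
  obtain ⟨x, hx, rfl⟩ := Finset.mem_image.1 ho
  obtain rfl := hN x
  let θ := MulAction.ofQuotientStabilizer G x
  have hθ : Function.Injective θ := MulAction.injective_ofQuotientStabilizer G x
  have hθs : ∀ (g : G) q, θ (g • q) = g • θ q := MulAction.ofQuotientStabilizer_smul G x
  have hθπ : ∀ q, π (θ q) = π x := fun q => by
    induction q using QuotientGroup.induction_on with
    | H g => exact hπ g x
  have hsurj : ∀ y, π y = π x → ∃ q, θ q = y := fun y hy => by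
    obtain ⟨g, rfl⟩ := MulAction.orbitRel_apply.1 (Quotient.exact hy)
    exact ⟨(g : G ⧸ _), rfl⟩
  have hmem : ∀ q, q ∈ F.preimage θ hθ.injOn ↔ θ q ∈ F := fun q => Finset.mem_preimage
  refine ⟨F.preimage θ hθ.injOn, ⟨((1 : G) : G ⧸ _), ?_⟩, ?_⟩
  · rw [hmem]
    change (1 : G) • x ∈ F
    rwa [one_smul]
  · have h3 : (F.filter fun y => π y = π x).card ≤ (F.preimage θ hθ.injOn).card := by
      refine Finset.card_le_card_of_surjOn θ ?_
      intro y hy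
      rw [Finset.coe_filter, Set.mem_ofPred_eq] at hy
      obtain ⟨q, rfl⟩ := hsurj y hy.2
      exact ⟨q, (hmem q).2 hy.1, rfl⟩
    have h4 : (displaced K (F.preimage θ hθ.injOn)).card ≤
        (b.filter fun p => π p.2 = π x).card := by
      refine Finset.card_le_card_of_injOn (fun p => (p.1, θ p.2)) ?_ ?_
      · rintro ⟨k, q⟩ hp
        simp only [Finset.mem_coe, mem_displaced, hmem, hθs] at hp
        simp only [hb, Finset.mem_coe, Finset.mem_filter, mem_displaced]
        exact ⟨hp, hθπ q⟩
      · rintro ⟨k, f⟩ _ ⟨k', f'⟩ _ h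
        simp only [Prod.mk.injEq] at h
        rw [h.1, hθ h.2]
    calc _ ≤ ((b.filter fun p => π p.2 = π x).card : ℝ) := by exact_mod_cast h4
      _ ≤ _ := hle
      _ ≤ _ := by gcongr

/-- `G` acts on `P` through `ψ` by left translation, and every stabiliser is the kernel because
translation is free. -/
theorem FolnerAction.quotient_ker {G P : Type*} [Group G] [Group P] (h : FolnerAction P P)
    (ψ : G →* P) : FolnerAction G (G ⧸ ψ.ker) := by
  let _ : MulAction G P := MulAction.compHom P ψ
  refine (h.comp_hom ψ fun _ _ => rfl).of_stabilizer_eq ψ.ker fun x => ?_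
  ext g
  rw [MulAction.mem_stabilizer_iff, MonoidHom.mem_ker]
  exact mul_eq_right

/-- The Følner condition for coset actions is transitive in towers of subgroups. -/
theorem FolnerAction.tower {G : Type*} [Group G] {N L : Subgroup G} (hNL : N ≤ L)
    (h₁ : FolnerAction G (G ⧸ L)) (h₂ : FolnerAction L (L ⧸ N.subgroupOf L)) :
    FolnerAction G (G ⧸ N) := by
  intro K ε hε
  obtain ⟨F₁, hne₁, hF₁⟩ := h₁ K (ε / 2) (by positivity)
  -- The cocycle of the chosen representatives: `k` carries the representative of `q` to that of `k
  -- • q` times an element of `L`, which then acts on the fibre `L ⧸ N`.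
  have hn : ∀ (k : G) (q : G ⧸ L), (k • q).out⁻¹ * (k * q.out) ∈ L := by
    intro k q
    rw [← QuotientGroup.eq, QuotientGroup.out_eq', ← smul_eq_mul, ← MulAction.Quotient.smul_mk,
      QuotientGroup.out_eq']
  let n : G → G ⧸ L → L := fun k q => ⟨_, hn k q⟩
  -- `F₂` must be nearly invariant under all cocycle values over `K × F₁`. The tolerance pays for
  -- counting its displaced pairs once for each element of `K × F₁`.
  obtain ⟨F₂, hne₂, hF₂⟩ := h₂ ((K ×ˢ F₁).image fun p => n p.1 p.2) (ε / (2 * (K.card * F₁.card + 1)))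
    (by positivity)
  let ι : (G ⧸ L) × (L ⧸ N.subgroupOf L) → G ⧸ N := fun p => ((p.1.out * (p.2.out : L) : G) : G ⧸ N)
  have hι : Function.Injective ι := by
    rintro ⟨q, t⟩ ⟨q', t'⟩ h
    have h1 := QuotientGroup.eq.1 h
    simp only [mul_inv_rev] at h1
    have hq : q = q' := by
      rw [← QuotientGroup.out_eq' q, ← QuotientGroup.out_eq' q', QuotientGroup.eq]
      have h2 := L.mul_mem (L.mul_mem t.out.2 (hNL h1)) (L.inv_mem t'.out.2)
      simpa [mul_assoc] using h2
    subst hq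
    congr 1
    rw [← QuotientGroup.out_eq' t, ← QuotientGroup.out_eq' t', QuotientGroup.eq,
      Subgroup.mem_subgroupOf]
    simpa [mul_assoc] using h1
  have hιs : ∀ (k : G) q t, k • ι (q, t) = ι (k • q, n k q • t) := by
    intro k q t
    obtain ⟨z, hz⟩ := QuotientGroup.mk_out_eq_mul (N.subgroupOf L) (n k q * t.out)
    have hz' : (n k q • t).out = n k q * t.out * z := by
      rw [← hz, ← smul_eq_mul, ← MulAction.Quotient.smul_mk, QuotientGroup.out_eq']
    change ((k • (q.out * (t.out : G)) : G) : G ⧸ N) = (((k • q).out * ((n k q • t).out : L) : G) : G ⧸ N)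
    rw [hz', QuotientGroup.eq]
    have := Subgroup.mem_subgroupOf.1 z.2
    simpa [n, mul_assoc] using this
  refine ⟨(F₁ ×ˢ F₂).image ι, (hne₁.product hne₂).image ι, ?_⟩
  rw [Finset.card_image_of_injective _ hι, Finset.card_product]
  set b₁ := displaced K F₁
  set b₂ := displaced ((K ×ˢ F₁).image fun p => n p.1 p.2) F₂
  have hcard : (displaced K ((F₁ ×ˢ F₂).image ι)).card ≤
      b₁.card * F₂.card + (K.card * F₁.card) * b₂.card := by
    rw [← Finset.card_product, ← Finset.card_product, ← Finset.card_product]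
    refine (Finset.card_le_card (t := (b₁ ×ˢ F₂).image (fun p => (p.1.1, ι (p.1.2, p.2))) ∪
      ((K ×ˢ F₁) ×ˢ b₂).image (fun p => (p.1.1, ι (p.1.2, p.2.2)))) ?_).trans
      ((Finset.card_union_le _ _).trans (add_le_add Finset.card_image_le Finset.card_image_le))
    rintro ⟨k, y⟩ hp
    simp only [mem_displaced, Finset.mem_product, Finset.mem_image, Prod.exists] at hp
    obtain ⟨⟨hk, q, t, ⟨hq, ht⟩, rfl⟩, hnot⟩ := hp
    rw [Finset.mem_union]
    -- A displaced point leaves either the fibre part `F₂` or the base part `F₁`.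
    by_cases hkq : k • q ∈ F₁
    · right
      refine Finset.mem_image.2 ⟨((k, q), (n k q, t)), ?_, rfl⟩
      simp only [Finset.mem_product, b₂, mem_displaced]
      refine ⟨⟨hk, hq⟩, ⟨Finset.mem_image.2 ⟨(k, q), by simp [hk, hq], rfl⟩, ht⟩, fun h' => ?_⟩
      exact hnot ⟨_, _, ⟨hkq, h'⟩, (hιs k q t).symm⟩
    · left
      refine Finset.mem_image.2 ⟨((k, q), t), ?_, rfl⟩
      simp only [Finset.mem_product, b₁, mem_displaced]
      exact ⟨⟨⟨hk, hq⟩, hkq⟩, ht⟩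
  have hcard' : ((displaced K ((F₁ ×ˢ F₂).image ι)).card : ℝ) ≤
      b₁.card * F₂.card + (K.card * F₁.card) * b₂.card := by exact_mod_cast hcard
  have h3 : (b₁.card : ℝ) * F₂.card ≤ ε / 2 * F₁.card * F₂.card := by gcongr
  have hpos : (1 : ℝ) ≤ F₁.card := by exact_mod_cast hne₁.card_pos
  have h4 : ((K.card : ℝ) * F₁.card) * b₂.card ≤ ε / 2 * F₁.card * F₂.card := by
    rw [div_mul_eq_mul_div, le_div_iff₀ (by positivity)] at hF₂
    have h5 : (0 : ℝ) ≤ b₂.card := by positivity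
    have h6 : ε * F₂.card ≤ ε * F₂.card * F₁.card := le_mul_of_one_le_right (by positivity) hpos
    nlinarith
  push_cast
  linarith

/-- Variant of `FolnerAction.tower` in which the smaller subgroup is a kernel. -/
theorem FolnerAction.tower_ker {G P : Type*} [Group G] [Group P] {N L : Subgroup G}
    (h₁ : FolnerAction G (G ⧸ L)) (h₂ : FolnerAction P P) (ψ : L →* P)
    (hN : ∀ g, g ∈ N ↔ ∃ h : g ∈ L, ψ ⟨g, h⟩ = 1) : FolnerAction G (G ⧸ N) := by
  refine h₁.tower (fun g hg => ((hN g).1 hg).1) ?_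
  have : N.subgroupOf L = ψ.ker := by
    ext ⟨g, hg⟩
    rw [Subgroup.mem_subgroupOf, MonoidHom.mem_ker]
    exact ⟨fun h => ((hN g).1 h).2, fun h => (hN g).2 ⟨hg, h⟩⟩
  rw [this]
  exact h₂.quotient_ker ψ

/-- The kernels are imposed one at a time, each step being an extension by a subgroup of `P`. -/
theorem FolnerAction.tower_iInf_ker {G P ι : Type*} [Group G] [Group P] {L : Subgroup G}
    (h₁ : FolnerAction G (G ⧸ L)) (h₂ : FolnerAction P P) (ψ : ι → L →* P) (s : Finset ι)
    (N : Subgroup G) (hN : ∀ g, g ∈ N ↔ ∃ h : g ∈ L, ∀ i ∈ s, ψ i ⟨g, h⟩ = 1) :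
    FolnerAction G (G ⧸ N) := by
  induction s using Finset.induction_on generalizing N with
  | empty =>
    have : N = L := by
      ext g
      simp [hN g]
    rwa [this]
  | insert a s ha ih =>
    have key : ∀ g, g ∈ (⨅ i ∈ s, (ψ i).ker).map L.subtype ↔
        ∃ h : g ∈ L, ∀ i ∈ s, ψ i ⟨g, h⟩ = 1 := by
      intro g
      simp only [Subgroup.mem_map, Subgroup.mem_iInf, MonoidHom.mem_ker]
      constructor
      · rintro ⟨x, hx, rfl⟩
        exact ⟨x.2, hx⟩
      · rintro ⟨h, hx⟩
        exact ⟨⟨g, h⟩, hx, rfl⟩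
    refine (ih _ key).tower_ker h₂
      ((ψ a).comp (Subgroup.inclusion fun g hg => ((key g).1 hg).1)) fun g => ?_
    rw [hN]
    constructor
    · rintro ⟨h, hx⟩
      exact ⟨(key g).2 ⟨h, fun i hi => hx i (Finset.mem_insert_of_mem hi)⟩,
        hx a (Finset.mem_insert_self _ _)⟩
    · rintro ⟨h, hx⟩
      obtain ⟨h', hx'⟩ := (key g).1 h
      refine ⟨h', fun i hi => ?_⟩
      rcases Finset.mem_insert.1 hi with rfl | hi
      · exact hx
      · exact hx' i hi

/-- The same finite sets serve both actions. This passes between amenability of a quotient group and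
the `G`-action that extension arguments use. -/
theorem folner_quotient_iff {G : Type*} [Group G] (N : Subgroup G) [N.Normal] :
    FolnerAction (G ⧸ N) (G ⧸ N) ↔ FolnerAction G (G ⧸ N) := by
  constructor
  · intro h
    refine h.comp_hom (QuotientGroup.mk' N) fun g x => ?_
    induction x using QuotientGroup.induction_on with
    | H x => rfl
  · intro h K ε hε
    obtain ⟨F, hne, hF⟩ := h (K.image Quotient.out) ε hε
    refine ⟨F, hne, le_trans ?_ hF⟩
    norm_cast
    refine Finset.card_le_card_of_injOn (fun p => (p.1.out, p.2)) ?_ ?_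
    · rintro ⟨k, f⟩ hp
      rw [Finset.mem_coe, mem_displaced] at hp ⊢
      refine ⟨⟨Finset.mem_image_of_mem _ hp.1.1, hp.1.2⟩, ?_⟩
      have : k.out • f = k • f := by
        conv_rhs => rw [← QuotientGroup.out_eq' k]
        induction f using QuotientGroup.induction_on with
        | H x => rfl
      rw [this]
      exact hp.2
    · rintro ⟨k, f⟩ _ ⟨k', f'⟩ _ h
      simp only [Prod.mk.injEq] at h
      rw [← QuotientGroup.out_eq' k, ← QuotientGroup.out_eq' k', h.1, h.2]

/-- Finite intersections of normal subgroups with Følner quotients have Følner quotients. -/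
theorem folner_quotient_iInf {G ι : Type*} [Group G] (N : ι → Subgroup G) [∀ i, (N i).Normal]
    (s : Finset ι) (hN : ∀ i ∈ s, FolnerAction G (G ⧸ N i)) :
    FolnerAction G (G ⧸ ⨅ i ∈ s, N i) := by
  induction s using Finset.induction_on with
  | empty =>
    have : ⨅ i ∈ (∅ : Finset ι), N i = ⊤ := by simp
    rw [this]
    exact folner_of_finite
  | insert a s ha ih =>
    refine (ih fun i hi => hN i (Finset.mem_insert_of_mem hi)).tower_ker
      ((folner_quotient_iff (N a)).2 (hN a (Finset.mem_insert_self _ _)))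
      ((QuotientGroup.mk' (N a)).comp (Subgroup.subtype _)) fun g => ?_
    rw [Finset.iInf_insert, Subgroup.mem_inf]
    simp [and_comm]

end FolnerQuotient

/-! ### Units acting on `𝓗`-classes and Schützenberger groups -/

section Schutzenberger

variable {M : Type*} [Monoid M]

theorem greenL_mul_eq {x y m n : M} (h : greenL M x y) (hy : y * m = y * n) : x * m = x * n := by
  obtain ⟨⟨a, rfl⟩, -⟩ := greenL_iff.1 h
  rw [mul_assoc, hy, mul_assoc]

/-- A bijection between `𝓗`-classes that transports right translations to right translations
induces an embedding of Schützenberger groups. -/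
theorem exists_schutzenbergerGroup_injective_of_equiv {x y : M}
    (e : {z : M // greenH M z x} ≃ {z : M // greenH M z y})
    (he : ∀ m, ∃ m', ∀ h h' : {z : M // greenH M z x},
      (h' : M) = h * m → (e h' : M) = e h * m') :
    ∃ φ : schutzenbergerGroup x →* schutzenbergerGroup y, Function.Injective φ := by
  refine ⟨(e.permCongrHom.toMonoidHom.comp (schutzenbergerGroup x).subtype).codRestrict
    (schutzenbergerGroup y) ?_, ?_⟩
  · rintro ⟨σ, m, hm⟩
    obtain ⟨m', hm'⟩ := he m
    refine ⟨m', fun h => ?_⟩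
    change (e (σ (e.symm h)) : M) = h * m'
    rw [hm' _ _ (hm _), e.apply_symm_apply]
  · intro σ τ h
    exact Subtype.ext (e.permCongrHom.injective (congrArg Subtype.val h))

/-- By Green's lemma, left multiplications by `a` and `a'` are inverse bijections between the two
`𝓗`-classes. They commute with right translations. -/
theorem exists_schutzenbergerGroup_injective_of_greenL {x y : M} (h : greenL M x y) :
    ∃ φ : schutzenbergerGroup x →* schutzenbergerGroup y, Function.Injective φ := by
  obtain ⟨⟨a', ha'⟩, a, ha⟩ := greenL_iff.1 h
  have key : ∀ {x y a a' : M}, a' * y = x → a * x = y → ∀ z, greenH M z x →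
      greenH M (a * z) y ∧ a' * (a * z) = z := by
    intro x y a a' h' h z hz
    obtain ⟨⟨t, rfl⟩, -⟩ := greenR_iff.1 hz.2
    have h1 : a' * (a * (x * t)) = x * t := by
      rw [← mul_assoc a, h, ← mul_assoc, h']
    refine ⟨⟨?_, ?_⟩, h1⟩
    · refine (greenL M).trans ?_ ((greenL M).trans hz.1 ?_)
      · exact greenL_iff.2 ⟨⟨a, rfl⟩, a', h1⟩
      · exact greenL_iff.2 ⟨⟨a', h'⟩, a, h⟩
    · have := greenR_mul_left hz.2 a
      rwa [h] at this
  refine exists_schutzenbergerGroup_injective_of_equiv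
    ⟨fun z => ⟨a * z, (key ha' ha z z.2).1⟩, fun z => ⟨a' * z, (key ha ha' z z.2).1⟩,
      fun z => Subtype.ext (key ha' ha z z.2).2, fun z => Subtype.ext (key ha ha' z z.2).2⟩
    fun m => ⟨m, fun h h' hm => ?_⟩
  change a * (h' : M) = a * h * m
  rw [hm, mul_assoc]

/-- The dual bijection is right multiplication by `a`, which turns translation by `m` into
translation by `a' * m * a`. -/
theorem exists_schutzenbergerGroup_injective_of_greenR {x y : M} (h : greenR M x y) :
    ∃ φ : schutzenbergerGroup x →* schutzenbergerGroup y, Function.Injective φ := by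
  obtain ⟨⟨a', ha'⟩, a, ha⟩ := greenR_iff.1 h
  have key : ∀ {x y a a' : M}, y * a' = x → x * a = y → ∀ z, greenH M z x →
      greenH M (z * a) y ∧ z * a * a' = z := by
    intro x y a a' h' h z hz
    obtain ⟨⟨t, rfl⟩, -⟩ := greenL_iff.1 hz.1
    have h1 : t * x * a * a' = t * x := by
      rw [mul_assoc t, h, mul_assoc, h']
    refine ⟨⟨?_, ?_⟩, h1⟩
    · have := greenL_mul_right hz.1 a
      rwa [h] at this
    · refine (greenR M).trans ?_ ((greenR M).trans hz.2 ?_)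
      · exact greenR_iff.2 ⟨⟨a, rfl⟩, a', h1⟩
      · exact greenR_iff.2 ⟨⟨a', h'⟩, a, h⟩
  refine exists_schutzenbergerGroup_injective_of_equiv
    ⟨fun z => ⟨z * a, (key ha' ha z z.2).1⟩, fun z => ⟨z * a', (key ha ha' z z.2).1⟩,
      fun z => Subtype.ext (key ha' ha z z.2).2, fun z => Subtype.ext (key ha ha' z z.2).2⟩
    fun m => ⟨a' * m * a, fun h h' hm => ?_⟩
  change (h' : M) * a = h * a * (a' * m * a)
  rw [hm, mul_assoc a', ← mul_assoc (h * a : M), (key ha' ha h h.2).2, mul_assoc]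

/-- Schützenberger groups of `𝓗`-classes in the same `𝓓`-class embed into each other. -/
theorem exists_schutzenbergerGroup_injective {x y : M} (h : greenD M x y) :
    ∃ φ : schutzenbergerGroup x →* schutzenbergerGroup y, Function.Injective φ := by
  obtain ⟨z, hL, hR⟩ := h
  obtain ⟨φ, hφ⟩ := exists_schutzenbergerGroup_injective_of_greenL hL
  obtain ⟨φ', hφ'⟩ := exists_schutzenbergerGroup_injective_of_greenR hR
  exact ⟨φ'.comp φ, hφ'.comp hφ⟩

theorem HClass.mk_eq_mk {x y : M} : HClass.mk x = HClass.mk y ↔ greenH M x y :=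
  Quotient.eq (r := greenH M)

theorem DClass.mk_eq_mk {x y : M} : DClass.mk x = DClass.mk y ↔ greenD M x y :=
  Quotient.eq (r := greenD M)

/-- Units that stabilise the `𝓗`-class of `w` permute this `𝓗`-class. -/
def stabilizerToSchutzenberger (w : M) :
    MulAction.stabilizer (Mˣ)ᵐᵒᵖ (HClass.mk w) →* schutzenbergerGroup w :=
  have key : ∀ n : (Mˣ)ᵐᵒᵖ, n ∈ MulAction.stabilizer (Mˣ)ᵐᵒᵖ (HClass.mk w) →
      ∀ z, greenH M z w → greenH M (z * (n.unop : Mˣ)) w := fun n hn z hz => by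
    rw [← HClass.mk_eq_mk] at hz ⊢
    rw [← HClass.op_smul_mk, hz]
    exact hn
  { toFun n := ⟨⟨fun z => ⟨z * (n.1.unop : Mˣ), key _ n.2 z z.2⟩,
        fun z => ⟨z * ((n⁻¹).1.unop : Mˣ), key _ (n⁻¹).2 z z.2⟩,
        fun z => Subtype.ext (by simp), fun z => Subtype.ext (by simp)⟩,
      (n.1.unop : Mˣ), fun _ => rfl⟩
    map_one' := by
      ext z
      simp
    map_mul' := fun n n' => by
      ext z
      simp [mul_assoc] }

/-- Every element of the `𝓗`-class lies in `M w`, so a right translation fixing `w` fixes the whole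
class. -/
theorem stabilizerToSchutzenberger_eq_one {w : M}
    {n : MulAction.stabilizer (Mˣ)ᵐᵒᵖ (HClass.mk w)} :
    stabilizerToSchutzenberger w n = 1 ↔ w * (n.1.unop : Mˣ) = w := by
  constructor
  · intro h
    have h1 := congrArg (fun σ : schutzenbergerGroup w =>
      ((σ.1 ⟨w, (greenH M).refl w⟩ : {z : M // greenH M z w}) : M)) h
    exact h1
  · intro h
    ext z
    change (z : M) * (n.1.unop : Mˣ) = z
    have := greenL_mul_eq (n := 1) z.2.1 (h.trans (mul_one w).symm)
    rwa [mul_one] at this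

/-- The units that fix the orbit `m G` pointwise under right translation. -/
def orbitFixer (m : M) : Subgroup (Mˣ)ᵐᵒᵖ where
  carrier := {n | ∀ g : Mˣ, m * g * (n.unop : Mˣ) = m * g}
  one_mem' := fun g => by simp
  mul_mem' := fun {a b} ha hb g => by
    rw [MulOpposite.unop_mul, Units.val_mul, ← mul_assoc, hb, ha]
  inv_mem' := fun {a} ha g => by
    rw [MulOpposite.unop_inv, Units.mul_inv_eq_iff_eq_mul, ha]

theorem mem_orbitFixer {m : M} {n : (Mˣ)ᵐᵒᵖ} :
    n ∈ orbitFixer m ↔ ∀ g : Mˣ, m * g * (n.unop : Mˣ) = m * g := Iff.rfl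

instance orbitFixer_normal (m : M) : (orbitFixer m).Normal := by
  refine ⟨fun n hn g h => ?_⟩
  have := hn (h * (g.unop)⁻¹)
  simp only [MulOpposite.unop_mul, MulOpposite.unop_inv, Units.val_mul, ← mul_assoc] at this ⊢
  rw [this]
  simp

theorem orbitFixer_le (m : M) :
    orbitFixer m ≤ fixingSubgroup (Mˣ)ᵐᵒᵖ (MulAction.orbit (Mˣ)ᵐᵒᵖ (HClass.mk m)) := by
  intro n hn
  rw [mem_fixingSubgroup_iff]
  rintro _ ⟨g, rfl⟩
  change HClass.mk (m * (g.unop : Mˣ) * (n.unop : Mˣ)) = HClass.mk (m * (g.unop : Mˣ))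
  rw [hn]

/-- The pointwise stabiliser of an orbit of `𝓗`-classes embeds, modulo the units which fix
`m G` pointwise, into a power of the Schützenberger group. -/
theorem exists_family_schutzenberger {m x : M} (hx : greenD M m x) :
    ∃ ψ : MulAction.orbit (Mˣ)ᵐᵒᵖ (HClass.mk m) →
      fixingSubgroup (Mˣ)ᵐᵒᵖ (MulAction.orbit (Mˣ)ᵐᵒᵖ (HClass.mk m)) →* schutzenbergerGroup x,
      ∀ n, n ∈ orbitFixer m ↔ ∃ h : n ∈ fixingSubgroup (Mˣ)ᵐᵒᵖ
        (MulAction.orbit (Mˣ)ᵐᵒᵖ (HClass.mk m)), ∀ i, ψ i ⟨n, h⟩ = 1 := by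
  choose r hr using fun i : MulAction.orbit (Mˣ)ᵐᵒᵖ (HClass.mk m) => i.2
  have hr' : ∀ i, HClass.mk (m * ((r i).unop : Mˣ)) = i := hr
  have hD : ∀ i, greenD M (m * ((r i).unop : Mˣ)) x := fun i =>
    (greenD M).trans ⟨_, (greenL M).refl _, greenR_mul_unit m _⟩ hx
  choose φ hφ using fun i => exists_schutzenbergerGroup_injective (hD i)
  have hle : ∀ i, fixingSubgroup (Mˣ)ᵐᵒᵖ (MulAction.orbit (Mˣ)ᵐᵒᵖ (HClass.mk m)) ≤
      MulAction.stabilizer (Mˣ)ᵐᵒᵖ (HClass.mk (m * ((r i).unop : Mˣ))) := fun i n hn => by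
    rw [MulAction.mem_stabilizer_iff, hr']
    exact (mem_fixingSubgroup_iff _).1 hn _ i.2
  refine ⟨fun i => ((φ i).comp (stabilizerToSchutzenberger _)).comp (Subgroup.inclusion (hle i)),
    fun n => ?_⟩
  have hψ : ∀ (i) (h : n ∈ fixingSubgroup (Mˣ)ᵐᵒᵖ (MulAction.orbit (Mˣ)ᵐᵒᵖ (HClass.mk m))),
      (((φ i).comp (stabilizerToSchutzenberger _)).comp (Subgroup.inclusion (hle i))) ⟨n, h⟩ = 1 ↔
      m * ((r i).unop : Mˣ) * (n.unop : Mˣ) = m * ((r i).unop : Mˣ) := by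
    intro i h
    rw [MonoidHom.comp_apply, MonoidHom.comp_apply, map_eq_one_iff _ (hφ i),
      stabilizerToSchutzenberger_eq_one]
    rfl
  simp only [hψ]
  constructor
  · exact fun hn => ⟨orbitFixer_le m hn, fun i => hn _⟩
  · rintro ⟨-, h⟩ g
    -- `m * g` is `𝓛`-related to the chosen representative of its `𝓗`-class, so a unit fixing the
    -- representative fixes `m * g` as well.
    have h1 := HClass.mk_eq_mk.1
      (hr' ⟨HClass.mk (m * g), MulOpposite.op g, HClass.op_smul_mk g m⟩)
    have h2 := greenL_mul_eq (n := 1) ((greenL M).symm h1.1) ((h _).trans (mul_one _).symm)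
    rwa [mul_one] at h2

/-- All elements of `m G` are `𝓡`-related, so an `𝓗`-class in the orbit is determined by its
`𝓛`-class and the orbit is finite. Its pointwise stabiliser is then the kernel of a map to a finite
group, and finitely many maps to an amenable group cut out `orbitFixer m`. -/
theorem folner_orbitFixer_of_finite {m x : M} (hx : greenD M m x)
    (hfin : (DClass.mk m).lClasses.Finite) (h : IsAmenable (schutzenbergerGroup x)) :
    FolnerAction (Mˣ)ᵐᵒᵖ ((Mˣ)ᵐᵒᵖ ⧸ orbitFixer m) := by
  obtain ⟨ψ, hψ⟩ := exists_family_schutzenberger hx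
  have : Finite (MulAction.orbit (Mˣ)ᵐᵒᵖ (HClass.mk m)) := by
    let q : HClass M → Quotient (greenL M) :=
      Quotient.map' (s₁ := greenH M) (s₂ := greenL M) id fun _ _ h => h.1
    refine Set.Finite.of_finite_image (f := q) (hfin.subset ?_) ?_
    · rintro _ ⟨_, ⟨g, rfl⟩, rfl⟩
      exact ⟨m * (g.unop : Mˣ), DClass.mk_eq_mk.2 ⟨_, (greenL M).refl _, greenR_mul_unit m _⟩, rfl⟩
    · rintro _ ⟨g, rfl⟩ _ ⟨g', rfl⟩ h
      exact HClass.mk_eq_mk.2 ⟨Quotient.exact h,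
        (greenR M).trans (greenR_mul_unit m _) ((greenR M).symm (greenR_mul_unit m _))⟩
  have := Fintype.ofFinite (MulAction.orbit (Mˣ)ᵐᵒᵖ (HClass.mk m))
  refine FolnerAction.tower_iInf_ker ?_ h.folner ψ Finset.univ _ (by simpa using hψ)
  have hker : fixingSubgroup (Mˣ)ᵐᵒᵖ (MulAction.orbit (Mˣ)ᵐᵒᵖ (HClass.mk m)) =
      (MulAction.toPermHom (Mˣ)ᵐᵒᵖ (MulAction.orbit (Mˣ)ᵐᵒᵖ (HClass.mk m))).ker := by
    ext n
    simp only [mem_fixingSubgroup_iff, MonoidHom.mem_ker, Equiv.ext_iff, Subtype.forall,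
      Subtype.ext_iff]
    rfl
  rw [hker]
  exact folner_of_finite.quotient_ker _

/-- The orbit may be infinite, and an infinite power of an amenable group need not be amenable.
Being finite or abelian is what makes every power of the Schützenberger group satisfy the Følner
condition. -/
theorem folner_orbitFixer_of_isLocallyAmenable {m x : M} (hx : greenD M m x)
    (h : Finite (schutzenbergerGroup x) ∨ ∀ σ τ : schutzenbergerGroup x, σ * τ = τ * σ)
    (hloc : IsLocallyAmenable (Mˣ)ᵐᵒᵖ (DClass.mk m).hClasses) :
    FolnerAction (Mˣ)ᵐᵒᵖ ((Mˣ)ᵐᵒᵖ ⧸ orbitFixer m) := by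
  obtain ⟨ψ, hψ⟩ := exists_family_schutzenberger hx
  have hP : FolnerAction (MulAction.orbit (Mˣ)ᵐᵒᵖ (HClass.mk m) → schutzenbergerGroup x)
      (MulAction.orbit (Mˣ)ᵐᵒᵖ (HClass.mk m) → schutzenbergerGroup x) := by
    rcases h with h | h
    · exact folner_pi_of_finite
    · let _ : CommGroup (schutzenbergerGroup x) :=
        { (inferInstance : Group (schutzenbergerGroup x)) with mul_comm := h }
      exact folner_of_comm
  refine FolnerAction.tower_ker ?_ hP (MonoidHom.pi ψ) fun n => (hψ n).trans
    (exists_congr fun _ => funext_iff.symm)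
  have h1 := (folner_quotient_iff _).1 (hloc ⟨HClass.mk m, m, rfl, rfl⟩).folner
  have heq : fixingSubgroup (Mˣ)ᵐᵒᵖ (MulAction.orbit (Mˣ)ᵐᵒᵖ (HClass.mk m)) =
      fixingSubgroup (Mˣ)ᵐᵒᵖ (MulAction.orbit (Mˣ)ᵐᵒᵖ
        (⟨HClass.mk m, m, rfl, rfl⟩ : (DClass.mk m).hClasses)) := by
    ext n
    rw [mem_fixingSubgroup_iff, mem_fixingSubgroup_iff]
    constructor
    · rintro h _ ⟨g, rfl⟩
      exact Subtype.ext (h _ ⟨g, rfl⟩)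
    · rintro h _ ⟨g, rfl⟩
      exact congrArg Subtype.val (h _ ⟨g, rfl⟩)
  rwa [heq]

end Schutzenberger

/-! ### Sofic approximations with a single small exceptional set -/

section Approximation

theorem proportion_le_of_subset {X : Type} [Finite X] [Nonempty X] {p : X → Prop} {B : Set X}
    {ε : ℝ} (hB : (B.ncard : ℝ) ≤ ε * Nat.card X) (hp : ∀ x ∉ B, ¬ p x) : proportion p ≤ ε := by
  have hX : (0 : ℝ) < Nat.card X := by exact_mod_cast Nat.card_pos
  rw [proportion, div_le_iff₀ hX]
  refine le_trans ?_ hB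
  norm_cast
  exact Set.ncard_le_ncard (s := {x | p x}) fun x hx => by_contra fun h => hp x h hx

theorem le_proportion_of_subset {X : Type} [Finite X] [Nonempty X] {p : X → Prop} {B : Set X}
    {ε : ℝ} (hB : (B.ncard : ℝ) ≤ ε * Nat.card X) (hp : ∀ x ∉ B, p x) :
    1 - ε ≤ proportion p := by
  have hX : (0 : ℝ) < Nat.card X := by exact_mod_cast Nat.card_pos
  rw [proportion, le_div_iff₀ hX]
  have h1 : (Nat.card X : ℝ) ≤ Nat.card {x // p x} + B.ncard := by
    have h2 := Set.ncard_add_ncard_compl B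
    have h3 : Bᶜ.ncard ≤ Nat.card {x // p x} :=
      Set.ncard_le_ncard (t := {x | p x}) fun x hx => hp x hx
    exact_mod_cast (by omega : Nat.card X ≤ Nat.card {x // p x} + B.ncard)
  linarith

theorem ncard_le_of_proportion_le {X : Type} [Finite X] [Nonempty X] {p : X → Prop} {ε : ℝ}
    (h : proportion p ≤ ε) : (({x | p x} : Set X).ncard : ℝ) ≤ ε * Nat.card X := by
  have hX : (0 : ℝ) < Nat.card X := by exact_mod_cast Nat.card_pos
  rwa [proportion, div_le_iff₀ hX] at h

theorem ncard_not_le_of_le_proportion {X : Type} [Finite X] [Nonempty X] {p : X → Prop} {ε : ℝ}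
    (h : 1 - ε ≤ proportion p) : (({x | ¬ p x} : Set X).ncard : ℝ) ≤ ε * Nat.card X := by
  have hX : (0 : ℝ) < Nat.card X := by exact_mod_cast Nat.card_pos
  rw [proportion, le_div_iff₀ hX] at h
  have h1 : (({x | p x} : Set X).ncard : ℝ) + ({x | ¬ p x} : Set X).ncard = Nat.card X := by
    exact_mod_cast Set.ncard_add_ncard_compl {x | p x}
  have h2 : (Nat.card {x // p x} : ℝ) = ({x | p x} : Set X).ncard := rfl
  rw [h2] at h
  linarith

theorem isSoficMonoid_of_approx {M : Type*} [Monoid M]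
    (H : ∀ (K : Finset M) (ε : ℝ), 0 < ε →
      ∃ (X : Type) (_ : Finite X) (_ : Nonempty X) (act : M → X → X) (B : Set X),
        (B.ncard : ℝ) ≤ ε * Nat.card X ∧ (∀ x, act 1 x = x) ∧ ∀ x ∉ B, ∀ g ∈ K, ∀ h ∈ K,
          act g (act h x) = act (g * h) x ∧ (g ≠ h → act g x ≠ act h x)) :
    IsSoficMonoid M := by
  intro K ε hε
  obtain ⟨X, hX, hX', act, B, hB, h1, hact⟩ := H K ε hε
  exact ⟨X, hX, hX', act, h1,
    fun g hg h hh => le_proportion_of_subset hB fun x hx => (hact x hx g hg h hh).1,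
    fun g hg h hh hne => proportion_le_of_subset hB fun x hx => (hact x hx g hg h hh).2 hne⟩

/-- The approximating sets may be taken in any universe. -/
theorem isSoficMonoid_of_approx_univ.{u, v} {M : Type v} [Monoid M]
    (H : ∀ (K : Finset M) (ε : ℝ), 0 < ε →
      ∃ (X : Type u) (_ : Finite X) (_ : Nonempty X) (act : M → X → X) (B : Set X),
        (B.ncard : ℝ) ≤ ε * Nat.card X ∧ (∀ x, act 1 x = x) ∧ ∀ x ∉ B, ∀ g ∈ K, ∀ h ∈ K,
          act g (act h x) = act (g * h) x ∧ (g ≠ h → act g x ≠ act h x)) :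
    IsSoficMonoid M := by
  refine isSoficMonoid_of_approx fun K ε hε => ?_
  obtain ⟨X, hX, hX', act, B, hB, h1, hact⟩ := H K ε hε
  let e := Finite.equivFin X
  refine ⟨Fin (Nat.card X), inferInstance, ⟨e hX'.some⟩, fun m x => e (act m (e.symm x)),
    e '' B, ?_, fun x => by simp [h1], fun x hx g hg h hh => ?_⟩
  · rwa [Set.ncard_image_of_injective _ e.injective, Nat.card_fin]
  · have hx' : e.symm x ∉ B := fun h' => hx ⟨_, h', by simp⟩
    obtain ⟨h2, h3⟩ := hact _ hx' g hg h hh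
    simp only [Equiv.symm_apply_apply]
    exact ⟨by rw [h2], fun hne h' => h3 hne (e.injective h')⟩

-- The finitely many exceptional sets are united into one, and `φ 1` is replaced by the identity.
-- Off the exceptional set this changes nothing, since there `φ 1` already fixes `y`.
open scoped Classical in
theorem IsSoficGroup.exists_approx {G : Type*} [Group G] (hG : IsSoficGroup G) (K : Finset G)
    {ε : ℝ} (hε : 0 < ε) :
    ∃ (Y : Type) (_ : Finite Y) (_ : Nonempty Y) (φ : G → Y → Y) (B : Set Y),
      (B.ncard : ℝ) ≤ ε * Nat.card Y ∧ (∀ y, φ 1 y = y) ∧ ∀ y ∉ B, ∀ g ∈ K, ∀ h ∈ K,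
        φ g (φ h y) = φ (g * h) y ∧ (g ≠ h → φ g y ≠ φ h y) := by
  let K' := insert 1 K
  have hK' : 0 < K'.card := Finset.card_pos.2 (Finset.insert_nonempty _ _)
  have h0 : (0 : ℝ) < (K'.card * K'.card : ℕ) := by exact_mod_cast Nat.mul_pos hK' hK'
  -- There are `|K'|²` pairs, each contributing two exceptional sets.
  let δ : ℝ := ε / (2 * (K'.card * K'.card : ℕ))
  obtain ⟨Y, hY, hY', φ, hmul, hne⟩ := hG K' δ (by positivity)
  let B₁ : G × G → Set Y := fun p => {y | φ (p.1 * p.2) y ≠ (φ p.1 * φ p.2) y}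
  let B₂ : G × G → Set Y := fun p => {y | p.1 ≠ p.2 ∧ ¬ (φ p.1 y ≠ φ p.2 y)}
  let B : Set Y := ⋃ p ∈ K' ×ˢ K', B₁ p ∪ B₂ p
  have hB : (B.ncard : ℝ) ≤ ε * Nat.card Y := by
    calc (B.ncard : ℝ) ≤ ∑ p ∈ K' ×ˢ K', ((B₁ p ∪ B₂ p).ncard : ℝ) := by
          exact_mod_cast Finset.set_ncard_biUnion_le _ _
      _ ≤ ∑ p ∈ K' ×ˢ K', (2 * δ * Nat.card Y) := by
          refine Finset.sum_le_sum fun p hp => ?_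
          rw [Finset.mem_product] at hp
          have h1 : ((B₁ p).ncard : ℝ) ≤ δ * Nat.card Y :=
            ncard_le_of_proportion_le (hmul _ hp.1 _ hp.2)
          have h2 : ((B₂ p).ncard : ℝ) ≤ δ * Nat.card Y := by
            by_cases h : p.1 = p.2
            · have : B₂ p = ∅ := by simp [B₂, h]
              rw [this, Set.ncard_empty, Nat.cast_zero]
              positivity
            · have : B₂ p = {y | ¬ (φ p.1 y ≠ φ p.2 y)} := by simp [B₂, h]
              rw [this]
              exact ncard_not_le_of_le_proportion (hne _ hp.1 _ hp.2 h)
          have h3 : ((B₁ p ∪ B₂ p).ncard : ℝ) ≤ (B₁ p).ncard + (B₂ p).ncard := by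
            exact_mod_cast Set.ncard_union_le _ _
          linarith
      _ = ε * Nat.card Y := by
          rw [Finset.sum_const, Finset.card_product, nsmul_eq_mul]
          simp only [δ]
          field_simp
  refine ⟨Y, hY, hY', fun g => if g = 1 then id else φ g, B, hB, fun y => by simp,
    fun y hy g hg h hh => ?_⟩
  have hgood : ∀ g ∈ K', ∀ h ∈ K', φ (g * h) y = φ g (φ h y) ∧ (g ≠ h → φ g y ≠ φ h y) := by
    intro g hg h hh
    have h1 : y ∉ B₁ (g, h) ∪ B₂ (g, h) := fun h' =>
      hy (Set.mem_biUnion (x := (g, h)) (by simpa using ⟨hg, hh⟩) h')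
    rw [Set.mem_union, not_or] at h1
    exact ⟨not_not.1 h1.1, fun hgh h2 => h1.2 ⟨hgh, not_not.2 h2⟩⟩
  have h1 : (1 : G) ∈ K' := Finset.mem_insert_self _ _
  have hg' : g ∈ K' := Finset.mem_insert_of_mem hg
  have hh' : h ∈ K' := Finset.mem_insert_of_mem hh
  have hone : φ 1 y = y := by
    have := (hgood 1 h1 1 h1).1
    rw [mul_one] at this
    exact ((φ 1).injective this).symm
  have hval : ∀ k, (if k = 1 then id else (φ k : Y → Y)) y = φ k y := by
    intro k
    split_ifs with hk
    · rw [hk, hone]; rfl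
    · rfl
  simp only [hval]
  refine ⟨?_, (hgood g hg' h hh').2⟩
  rw [(hgood g hg' h hh').1]
  split_ifs with hg1
  · subst hg1
    rw [← (hgood 1 hg' h hh').1, one_mul]
    rfl
  · rfl

end Approximation

/-! ### Non-units form an ideal -/

section Units

variable {M : Type*} [Monoid M]

/-- If `a * b` is a unit then `a` has a right inverse, so it generates `M` as a two-sided ideal and
lies in the `𝓙`-class of 1. By `hJ` that class consists of units. -/
theorem isUnit_left_of_mul (hJ : {x : M | greenJ M x 1} = {x : M | IsUnit x}) {a b : M}
    (h : IsUnit (a * b)) : IsUnit a := by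
  obtain ⟨u, hu⟩ := h
  refine (Set.ext_iff.1 hJ a).1 ?_
  change Set.range _ = Set.range _
  have h1 : a * (b * (u⁻¹ : Mˣ)) = 1 := by rw [← mul_assoc, ← hu, Units.mul_inv]
  ext z
  constructor
  · rintro ⟨p, rfl⟩
    exact ⟨(p.1 * a * p.2, 1), by simp⟩
  · rintro ⟨p, rfl⟩
    exact ⟨(p.1, b * (u⁻¹ : Mˣ) * p.2), by
      simp only [mul_one]
      rw [mul_assoc p.1, ← mul_assoc a, h1, one_mul]⟩

theorem isUnit_right_of_mul (hJ : {x : M | greenJ M x 1} = {x : M | IsUnit x}) {a b : M}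
    (h : IsUnit (a * b)) : IsUnit b := by
  have ha := isUnit_left_of_mul hJ h
  exact (ha.unit.isUnit_units_mul b).1 h

theorem isUnit_of_greenD (hJ : {x : M | greenJ M x 1} = {x : M | IsUnit x}) {x y : M}
    (h : greenD M x y) (hx : IsUnit x) : IsUnit y := by
  obtain ⟨z, hL, hR⟩ := h
  obtain ⟨⟨a, ha⟩, -⟩ := greenL_iff.1 hL
  obtain ⟨⟨b, hb⟩, -⟩ := greenR_iff.1 hR
  rw [← ha] at hx
  have hz := isUnit_right_of_mul hJ hx
  rw [← hb] at hz
  exact isUnit_left_of_mul hJ hz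

end Units

/-! ### The almost action built from a sofic approximation and a Følner set -/

section Construction

variable {M : Type*} [Monoid M]

/-- Right translation of `k` by the inverse of a representative of the coset `f`. -/
noncomputable def cosetTranslate {N : Subgroup (Mˣ)ᵐᵒᵖ} (f : (Mˣ)ᵐᵒᵖ ⧸ N) (k : M) : M :=
  k * ((f.out.unop)⁻¹ : Mˣ)

theorem cosetTranslate_mul {N : Subgroup (Mˣ)ᵐᵒᵖ} (f : (Mˣ)ᵐᵒᵖ ⧸ N) (g k : M) :
    cosetTranslate f (g * k) = g * cosetTranslate f k := mul_assoc _ _ _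

theorem cosetTranslate_injective {N : Subgroup (Mˣ)ᵐᵒᵖ} (f : (Mˣ)ᵐᵒᵖ ⧸ N) :
    Function.Injective (cosetTranslate f : M → M) := fun _ _ h =>
  (Units.mul_left_inj _).1 h

/-- The two representatives differ by an element of `N`, which fixes every element of `k G`. This is
the compatibility of a non-unit `k` with a preceding unit `h`. -/
theorem cosetTranslate_smul {N : Subgroup (Mˣ)ᵐᵒᵖ} {k : M} (hN : N ≤ orbitFixer k)
    (f : (Mˣ)ᵐᵒᵖ ⧸ N) (h : Mˣ) :
    cosetTranslate (MulOpposite.op h⁻¹ • f) k = cosetTranslate f (k * h) := by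
  obtain ⟨z, hz⟩ := QuotientGroup.mk_out_eq_mul N (MulOpposite.op h⁻¹ * f.out)
  rw [← smul_eq_mul, ← MulAction.Quotient.smul_mk, QuotientGroup.out_eq'] at hz
  have h1 := mem_orbitFixer.1 (hN (N.inv_mem z.2)) (h * (f.out.unop)⁻¹)
  simp only [cosetTranslate, hz]
  simpa [mul_assoc] using h1

open scoped Classical in
/-- The point `a` if it lies in `F`, and `b` otherwise. -/
noncomputable def moveWithin {α : Type*} (F : Finset α) (a : α) (b : F) : F :=
  if h : a ∈ F then ⟨a, h⟩ else b

theorem moveWithin_of_mem {α : Type*} {F : Finset α} {a : α} (b : F) (h : a ∈ F) :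
    moveWithin F a b = ⟨a, h⟩ := dif_pos h

open scoped Classical in
/-- The almost action of `M` on the disjoint union of `Y × F × ι`, on which units act through
`φ` and through translation of cosets, and a finite part `S` of `M`. -/
noncomputable def soficFolnerAct {Y ι : Type*} (φ : Mˣ → Y → Y) {N : Subgroup (Mˣ)ᵐᵒᵖ}
    (F : Finset ((Mˣ)ᵐᵒᵖ ⧸ N)) (S : Finset M) (m : M) : (Y × F × ι) ⊕ S → (Y × F × ι) ⊕ S :=
  Sum.elim
    (fun p => if hm : IsUnit m then
        Sum.inl (φ hm.unit p.1, moveWithin F (MulOpposite.op (hm.unit)⁻¹ • p.2.1.1) p.2.1, p.2.2)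
      -- Staying put is a default value for maps that would leave `S`; it plays no part in the good
      -- estimates.
      else if hp : cosetTranslate p.2.1.1 m ∈ S then Sum.inr ⟨_, hp⟩ else Sum.inl p)
    (fun s => Sum.inr (moveWithin S (m * s) s))

section

variable {Y ι : Type*} (φ : Mˣ → Y → Y) {N : Subgroup (Mˣ)ᵐᵒᵖ} (F : Finset ((Mˣ)ᵐᵒᵖ ⧸ N))
  (S : Finset M)

theorem soficFolnerAct_unit (u : Mˣ) (p : Y × F × ι) :
    soficFolnerAct φ F S u (Sum.inl p) =
      Sum.inl (φ u p.1, moveWithin F (MulOpposite.op u⁻¹ • p.2.1.1) p.2.1, p.2.2) := by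
  simp [soficFolnerAct]

theorem soficFolnerAct_of_not_isUnit {m : M} (hm : ¬ IsUnit m) (p : Y × F × ι)
    (hp : cosetTranslate p.2.1.1 m ∈ S) :
    soficFolnerAct φ F S m (Sum.inl p) = Sum.inr ⟨_, hp⟩ := by
  simp [soficFolnerAct, hm, hp]

theorem soficFolnerAct_inr (m : M) (s : S) (hs : m * s ∈ S) :
    soficFolnerAct (ι := ι) φ F S m (Sum.inr s) = Sum.inr ⟨_, hs⟩ := by
  simp [soficFolnerAct, moveWithin_of_mem, hs]

theorem soficFolnerAct_one (h1 : ∀ y, φ 1 y = y) (x : (Y × F × ι) ⊕ S) :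
    soficFolnerAct φ F S 1 x = x := by
  rcases x with p | s
  · have := soficFolnerAct_unit φ F S 1 p
    rw [Units.val_one] at this
    rw [this, h1, moveWithin_of_mem _ (by simp)]
    simp
  · rw [soficFolnerAct_inr _ _ _ _ _ (by simp)]
    simp

end

open scoped Classical Pointwise in
/-- A monoid with sofic group of units `G`, whose non-units form an ideal, is sofic if, for
every non-unit `m`, the action of `G` on the orbit `m G` factors through a Følner group. -/
theorem isSoficMonoid_of_folner
    (hJ : {x : M | greenJ M x 1} = {x : M | IsUnit x}) (hG : IsSoficGroup Mˣ)
    (hF : ∀ m : M, ¬ IsUnit m → FolnerAction (Mˣ)ᵐᵒᵖ ((Mˣ)ᵐᵒᵖ ⧸ orbitFixer m)) :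
    IsSoficMonoid M := by
  refine isSoficMonoid_of_approx_univ fun K ε hε => ?_
  let T : Finset Mˣ := K.preimage Units.val Units.val_injective.injOn
  -- Products are included so that the action of `u * v` also keeps a good coset inside `F`.
  let T' : Finset Mˣ := T ∪ T * T
  obtain ⟨N, hNle, hN⟩ : ∃ N : Subgroup (Mˣ)ᵐᵒᵖ, (∀ k ∈ K, ¬ IsUnit k → N ≤ orbitFixer k) ∧
      FolnerAction (Mˣ)ᵐᵒᵖ ((Mˣ)ᵐᵒᵖ ⧸ N) :=
    ⟨_, fun k hk hu => iInf₂_le k (Finset.mem_filter.2 ⟨hk, hu⟩),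
      folner_quotient_iInf orbitFixer (K.filter fun k => ¬ IsUnit k)
        fun k hk => hF k (Finset.mem_filter.1 hk).2⟩
  obtain ⟨F, hFne, hFd⟩ := hN (T'.image fun u => MulOpposite.op u⁻¹) (ε / 3) (by positivity)
  obtain ⟨Y, _, _, φ, BY, hBY, hφ1, hφ⟩ := hG.exists_approx T (ε := ε / 3) (by positivity)
  -- Translates of `K * K` are included so that left multiplication by `g ∈ K` sends the image of a
  -- good point under `h ∈ K` non-unit back into `S`.
  let S : Finset M := ((K ∪ K * K) ×ˢ F).image fun p => cosetTranslate p.2 p.1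
  have hS1 : ∀ k ∈ K, ∀ f ∈ F, cosetTranslate f k ∈ S := fun k hk f hf =>
    Finset.mem_image.2 ⟨(k, f), by simp [hk, hf], rfl⟩
  have hS2 : ∀ g ∈ K, ∀ k ∈ K, ∀ f ∈ F, cosetTranslate f (g * k) ∈ S := fun g hg k hk f hf =>
    Finset.mem_image.2 ⟨(g * k, f), by simp [Finset.mul_mem_mul hg hk, hf], rfl⟩
  -- Enough copies of `Y × F` for `S` to have proportion at most `ε / 3`.
  let t : ℕ := ⌈S.card * 3 / ε⌉₊
  have : Nonempty F := hFne.to_subtype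
  let BF : Finset ((Mˣ)ᵐᵒᵖ ⧸ N) := F.filter fun f => ∃ u ∈ T', MulOpposite.op u⁻¹ • f ∉ F
  have hBF : (BF.card : ℝ) ≤ ε / 3 * F.card := by
    refine le_trans ?_ hFd
    norm_cast
    refine Finset.card_le_card_of_surjOn Prod.snd ?_
    intro f hf
    obtain ⟨hf, u, hu, hn⟩ := Finset.mem_filter.1 (Finset.mem_coe.1 hf)
    exact ⟨(MulOpposite.op u⁻¹, f), mem_displaced.2 ⟨⟨Finset.mem_image_of_mem _ hu, hf⟩, hn⟩, rfl⟩
  -- Three kinds of bad points, each costing `ε / 3`: a bad point of `Y`, a coset that some unit in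
  -- `T'` moves out of `F`, and all of `S`.
  let B : Set ((Y × F × Fin (t + 1)) ⊕ S) :=
    Sum.inl '' (BY ×ˢ Set.univ) ∪ Sum.inl '' (Set.univ ×ˢ (Subtype.val ⁻¹' (BF : Set _)) ×ˢ Set.univ)
      ∪ Set.range Sum.inr
  refine ⟨(Y × F × Fin (t + 1)) ⊕ S, inferInstance, inferInstance, soficFolnerAct φ F S, B, ?_,
    soficFolnerAct_one φ F S hφ1, ?_⟩
  · have h1 : ((Sum.inl '' (BY ×ˢ Set.univ) : Set ((Y × F × Fin (t + 1)) ⊕ S)).ncard : ℝ) ≤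
        ε / 3 * (Nat.card Y * (F.card * (t + 1))) := by
      rw [Set.ncard_image_of_injective _ Sum.inl_injective, Set.ncard_prod, Set.ncard_univ,
        Nat.card_prod, Nat.card_eq_finsetCard, Nat.card_fin]
      push_cast
      rw [← mul_assoc (ε / 3)]
      exact mul_le_mul_of_nonneg_right hBY (by positivity)
    have h2 : ((Sum.inl '' (Set.univ ×ˢ (Subtype.val ⁻¹' (BF : Set _)) ×ˢ Set.univ) :
        Set ((Y × F × Fin (t + 1)) ⊕ S)).ncard : ℝ) ≤
        ε / 3 * (Nat.card Y * (F.card * (t + 1))) := by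
      have h3 : ((Subtype.val ⁻¹' (BF : Set _) : Set F).ncard) ≤ BF.card := by
        rw [← Set.ncard_coe_finset BF]
        exact Set.ncard_le_ncard_of_injOn Subtype.val (fun _ h => h) Subtype.val_injective.injOn
      have h3' : ((Subtype.val ⁻¹' (BF : Set _) : Set F).ncard : ℝ) ≤ ε / 3 * F.card :=
        le_trans (by exact_mod_cast h3) hBF
      rw [Set.ncard_image_of_injective _ Sum.inl_injective, Set.ncard_prod, Set.ncard_prod,
        Set.ncard_univ, Set.ncard_univ, Nat.card_fin]
      push_cast
      calc _ ≤ (Nat.card Y : ℝ) * (ε / 3 * F.card * (t + 1)) := by gcongr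
        _ = _ := by ring
    have h4 : ((Set.range Sum.inr : Set ((Y × F × Fin (t + 1)) ⊕ S)).ncard : ℝ) ≤
        ε / 3 * (Nat.card Y * (F.card * (t + 1))) := by
      have h5 : (Set.range Sum.inr : Set ((Y × F × Fin (t + 1)) ⊕ S)).ncard = S.card := by
        rw [← Set.image_univ, Set.ncard_image_of_injective _ Sum.inr_injective, Set.ncard_univ,
          Nat.card_eq_finsetCard]
      have h6 : (S.card * 3 / ε : ℝ) ≤ t := Nat.le_ceil _
      have h7 : (1 : ℝ) ≤ Nat.card Y := by exact_mod_cast Nat.card_pos (α := Y)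
      have h8 : (1 : ℝ) ≤ F.card := by exact_mod_cast hFne.card_pos
      rw [div_le_iff₀ hε] at h6
      rw [h5]
      calc (S.card : ℝ) ≤ ε / 3 * (1 * (1 * (t + 1))) := by linarith
        _ ≤ _ := by gcongr
    have h9 := (add_le_add (Nat.cast_le (α := ℝ).2 (Set.ncard_union_le
      (Sum.inl '' (BY ×ˢ Set.univ) : Set ((Y × F × Fin (t + 1)) ⊕ S))
      (Sum.inl '' (Set.univ ×ˢ (Subtype.val ⁻¹' (BF : Set _)) ×ˢ Set.univ)))) le_rfl).trans'
      (Nat.cast_le (α := ℝ).2 (Set.ncard_union_le _ (Set.range Sum.inr)) |>.trans_eq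
        (Nat.cast_add _ _))
    rw [Nat.cast_add] at h9
    change (B.ncard : ℝ) ≤ _ at h9
    have h10 : (Nat.card ((Y × F × Fin (t + 1)) ⊕ S) : ℝ) =
        Nat.card Y * (F.card * (t + 1)) + S.card := by
      rw [Nat.card_sum, Nat.card_prod, Nat.card_prod, Nat.card_eq_finsetCard,
        Nat.card_eq_finsetCard, Nat.card_fin]
      push_cast
      ring
    rw [h10]
    have h11 : 0 ≤ ε * S.card := by positivity
    linarith
  · rintro (⟨y, f, i⟩ | s) hx g hg h hh
    swap
    · exact absurd (Or.inr ⟨s, rfl⟩) hx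
    have hy : y ∉ BY := fun hy => hx (Or.inl (Or.inl ⟨_, by simpa using hy, rfl⟩))
    have hf : f.1 ∉ BF := fun hf => hx (Or.inl (Or.inr ⟨(y, f, i), by simpa using hf, rfl⟩))
    have hfm : ∀ u ∈ T', MulOpposite.op u⁻¹ • f.1 ∈ F := by
      intro u hu
      by_contra hn
      exact hf (Finset.mem_filter.2 ⟨f.2, u, hu, hn⟩)
    have hT : ∀ u : Mˣ, (u : M) ∈ K → u ∈ T := fun u hu => Finset.mem_preimage.2 hu
    have hT1 : ∀ u : Mˣ, (u : M) ∈ K → u ∈ T' := fun u hu => Finset.mem_union_left _ (hT u hu)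
    by_cases hhu : IsUnit h
    · obtain ⟨v, rfl⟩ := hhu
      by_cases hgu : IsUnit g
      · obtain ⟨u, rfl⟩ := hgu
        obtain ⟨hmul, hne⟩ := hφ y hy u (hT u hg) v (hT v hh)
        have huv : u * v ∈ T' := Finset.mem_union_right _ (Finset.mul_mem_mul (hT u hg) (hT v hh))
        have hsm : MulOpposite.op u⁻¹ • MulOpposite.op v⁻¹ • f.1 =
            MulOpposite.op (u * v)⁻¹ • f.1 := by
          rw [smul_smul, mul_inv_rev, MulOpposite.op_mul]
        rw [← Units.val_mul]
        simp only [soficFolnerAct_unit]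
        refine ⟨?_, fun huv h' => ?_⟩
        · simp only [moveWithin_of_mem _ (hfm v (hT1 v hh)), moveWithin_of_mem _ (hfm _ huv), hsm,
            hmul]
        · simp only [Sum.inl.injEq, Prod.mk.injEq] at h'
          exact hne (fun h => huv (congrArg _ h)) h'.1
      -- Unit first, then non-unit: both routes end in `S`, at the same point because `N` fixes `g
      -- G`. Distinctness is free, as `v` stays in the other summand.
      · have hghu : ¬ IsUnit (g * (v : M)) := fun h' => hgu (isUnit_left_of_mul hJ h')
        rw [soficFolnerAct_unit, moveWithin_of_mem _ (hfm v (hT1 v hh)),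
          soficFolnerAct_of_not_isUnit _ _ _ hghu _ (hS2 g hg _ hh _ f.2),
          soficFolnerAct_of_not_isUnit _ _ _ hgu _ (hS1 g hg _ (hfm v (hT1 v hh))),
          soficFolnerAct_of_not_isUnit _ _ _ hgu _ (hS1 g hg _ f.2)]
        refine ⟨?_, fun _ => Sum.inr_ne_inl⟩
        simp only [cosetTranslate_smul (hNle g hg hgu)]
    -- A non-unit `h` moves the point into `S`, where `g` acts by left multiplication. Distinct
    -- non-units are separated because translation by a unit is injective.
    · have hghu : ¬ IsUnit (g * h) := fun h' => hhu (isUnit_right_of_mul hJ h')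
      rw [soficFolnerAct_of_not_isUnit _ _ _ hhu _ (hS1 h hh _ f.2),
        soficFolnerAct_of_not_isUnit _ _ _ hghu _ (hS2 g hg h hh _ f.2),
        soficFolnerAct_inr _ _ _ _ _ (by rw [← cosetTranslate_mul]; exact hS2 g hg h hh _ f.2)]
      refine ⟨by simp only [cosetTranslate_mul], fun hne => ?_⟩
      by_cases hgu : IsUnit g
      · obtain ⟨u, rfl⟩ := hgu
        rw [soficFolnerAct_unit]
        exact Sum.inl_ne_inr
      · rw [soficFolnerAct_of_not_isUnit _ _ _ hgu _ (hS1 g hg _ f.2)]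
        intro h'
        exact hne (cosetTranslate_injective f.1 (congrArg Subtype.val (Sum.inr_injective h')))

end Construction

theorem theorem4p1 {M : Type*} [Monoid M]
    (hJ : {x : M | greenJ M x 1} = {x : M | IsUnit x})
    (hG : IsSoficGroup Mˣ)
    (hD : ∀ D : DClass M, (∀ x : M, DClass.mk x = D → ¬ IsUnit x) →
      (D.lClasses.Finite ∧
        ∃ x : M, DClass.mk x = D ∧ IsAmenable (schutzenbergerGroup x)) ∨
      ((∃ x : M, DClass.mk x = D ∧
          (Finite (schutzenbergerGroup x) ∨ ∀ σ τ : schutzenbergerGroup x, σ * τ = τ * σ)) ∧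
        IsLocallyAmenable (Mˣ)ᵐᵒᵖ D.hClasses)) :
    IsSoficMonoid M := by
  refine isSoficMonoid_of_folner hJ hG fun m hm => ?_
  rcases hD (DClass.mk m) fun x hx hu => hm (isUnit_of_greenD hJ (DClass.mk_eq_mk.1 hx) hu) with
    ⟨hfin, x, hx, h⟩ | ⟨⟨x, hx, h⟩, hloc⟩
  · exact folner_orbitFixer_of_finite (DClass.mk_eq_mk.1 hx.symm) hfin h
  · exact folner_orbitFixer_of_isLocallyAmenable (DClass.mk_eq_mk.1 hx.symm) h hloc
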